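/- An \(r\)-dimensional complex array \(A\) of size \(s_1\times\cdots\times s_r\) has entries \(A[i_1,\dots,i_r]\), \(0\le i_k<s_k\). Its weight is \(w(A)=\sum_{i_1,\dots,i_r}|A[i_1,\dots,i_r]|^2\), and we put \[ A(z)=\sum_{i_1,\dots,i_r}A[i_1,\dots,i_r]\,z_1^{i_1}\cdots z_r^{i_r},\qquad \overline{A(z^{-1})}=\sum_{i_1,\dots,i_r}\overline{A[i_1,\dots,i_r]}\,z_1^{-i_1}\cdots z_r^{-i_r}. \] A quaternary Golay complementary array (GCA) pair of size \(s_1\times\cdots\times s_r\) consists of two arrays \(A,B\) of that size, all of whose entries lie in \(\{1,-1,j,-j\}\) with \(j=\sqrt{-1}\), such that \[ A(z)\overline{A(z^{-1})}+B(z)\overline{B(z^{-1})}=w(A)+w(B) \] as Laurent polynomials in \(z_1,\dots,z_r\) (equivalently, the aperiodic autocorrelation functions of \(A\) and \(B\) add up to a multiple of the unit pulse). Let \(s_1,\dots,s_r\) be positive integers and \(a,b,c,d,e,u\ge 0\) integers such that \[ s_1\cdots s_r=2^{a+u}\,3^{b}\,5^{c}\,11^{d}\,13^{e},\qquad b+c+d+e\le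 a+2u+1,\qquad u\le c+e, \] and suppose that \(u\) factors, each equal to \(10\) or \(26\), can be chosen in this product so that none of them is split across different dimensions; that is, there are integers \(p_k,q_k\ge 0\) with \(\sum_{k=1}^{r}(p_k+q_k)=u\) and \(10^{p_k}26^{q_k}\mid s_k\) for every \(k\). Then there exists a quaternary GCA pair of size \(s_1\times\cdots\times s_r\). -/

import Mathlib

/-- An `r`-dimensional complex array of size `s 0 × ⋯ × s (r - 1)`, indexed from `(0, …, 0)`. -/
abbrev GArray {r : ℕ} (s : Fin r → ℕ) : Type := (∀ k, Fin (s k)) → ℂ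

namespace GArray

variable {r : ℕ} {s : Fin r → ℕ}

/-- Laurent polynomials over `ℂ` in the indeterminates `z_1, …, z_r`; the basis element
`AddMonoidAlgebra.single m 1` is the monomial `z_1 ^ m_1 ⋯ z_r ^ m_r`. -/
abbrev LaurentPoly (r : ℕ) : Type := AddMonoidAlgebra ℂ (Fin r → ℤ)

/-- The polynomial `A(z) = ∑ A[i_1, …, i_r] z_1 ^ i_1 ⋯ z_r ^ i_r` of an array. -/
noncomputable def poly (A : GArray s) : LaurentPoly r :=
  ∑ i, AddMonoidAlgebra.single (fun k => ((i k : ℕ) : ℤ)) (A i)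

/-- The Laurent polynomial `∑ conj (A[i_1, …, i_r]) z_1 ^ (-i_1) ⋯ z_r ^ (-i_r)`. -/
noncomputable def polyConjInv (A : GArray s) : LaurentPoly r :=
  ∑ i, AddMonoidAlgebra.single (fun k => -((i k : ℕ) : ℤ)) ((starRingEnd ℂ) (A i))

/-- The weight `∑ |A[i_1, …, i_r]|²` of an array. -/
noncomputable def weight (A : GArray s) : ℝ := ∑ i, ‖A i‖ ^ 2

/-- A family of arrays of the same size is a Golay complementary array (GCA) set if all entries
are unimodular or zero and the sum of the power spectra `A(z) * conj A (z⁻¹)` is the constant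
given by the total weight. -/
def IsGCASet {L : ℕ} (A : Fin L → GArray s) : Prop :=
  (∀ l i, A l i = 0 ∨ ‖A l i‖ = 1) ∧
    ∑ l, (A l).poly * (A l).polyConjInv =
      AddMonoidAlgebra.single 0 (((∑ l, (A l).weight : ℝ)) : ℂ)

/-- All entries of the array are fourth roots of unity. -/
def IsQuaternary (A : GArray s) : Prop :=
  ∀ i, A i = 1 ∨ A i = -1 ∨ A i = Complex.I ∨ A i = -Complex.I

/-- A quaternary GCA pair: a GCA set consisting of two quaternary arrays of the same size. -/
def IsQuaternaryGCAPair (A B : GArray s) : Prop :=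
  A.IsQuaternary ∧ B.IsQuaternary ∧ IsGCASet ![A, B]

/-- In the sizes `s 0, …, s (r - 1)` one can choose `u` factors, each equal to `10` or `26`, so
that every chosen factor lies entirely within one dimension: dimension `k` contains `p k` factors
`10` and `q k` factors `26`. -/
def HasUnsplitFactors (s : Fin r → ℕ) (u : ℕ) : Prop :=
  ∃ p q : Fin r → ℕ, ∑ k, (p k + q k) = u ∧ ∀ k, 10 ^ p k * 26 ^ q k ∣ s k

end GArray

/-!
A Golay pair `(C, D)` is the first row of a paraunitary matrix over the Laurent polynomials: its
second row is `(-y D*, y C*)`, where `*` is the involution `P(z) ↦ conj P(z⁻¹)` and `y` is a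
monomial that moves the exponents back into the box. Products of paraunitary matrices are
paraunitary, so rows of products satisfy the Golay identity again; the problem is to keep every
coefficient a fourth root of unity.

Let `(A, B)` be a binary pair of length `g` with `A i * B i = -A (g - 1 - i) * B (g - 1 - i)`. Then
`(A + B) / 2` and the reversal of `(A - B) / 2` are `±1` on the same half of the indices, and
`(A - B) / 2` and the reversal of `(A + B) / 2` on the other half. Half the sum and half the
difference within each of these two couples give four sequences whose supports partition
`0, …, g - 1`, and they form a paraunitary `2 × 2` matrix `N` (`paraunitary_step`). Therefore, for
quaternary pairs `(C, D)` and `(E, F)`, the row `(C, D) N` times the matrix of `(E, F)` has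
quaternary coefficients as soon as the exponents of the three ingredients add without collisions
(`HasPair.mul`). Mixed radix expansions achieve this, with `(A, B)` and `(E, F)` laid out in any
two directions (`exists_equiv_mul_mulSingle`).

So one even factor `g ∈ {2, 10, 26}` may be introduced alone or together with one odd factor
`m ∈ {3, 5, 11, 13}`, and the construction starts from at most one odd factor (`hasPair_dims`).
There are `a + u` even factors, and `b + c + d + e - u` odd ones outside the chosen `10`s and
`26`s, so the hypothesis `b + c + d + e ≤ a + 2 * u + 1` is what is needed.
-/

namespace GArray

open GaussianInt

/-! ### Laurent polynomials -/

/-- The involution `P(z) ↦ conj P(z⁻¹)` of the Laurent polynomial ring. -/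
noncomputable def bar (r : ℕ) : LaurentPoly r →+* LaurentPoly r :=
  (AddMonoidAlgebra.mapRingHom _ (starRingEnd ℂ)).comp
    (AddMonoidAlgebra.mapDomainRingHom ℂ (negAddMonoidHom : (Fin r → ℤ) →+ (Fin r → ℤ)))

variable {r : ℕ}

@[simp]
lemma bar_single (x : Fin r → ℤ) (c : ℂ) :
    bar r (AddMonoidAlgebra.single x c) = AddMonoidAlgebra.single (-x) ((starRingEnd ℂ) c) := by
  simp [bar]

lemma bar_bar (P : LaurentPoly r) : bar r (bar r P) = P := by
  induction P using AddMonoidAlgebra.induction_linear with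
  | zero => simp
  | add f g hf hg => rw [map_add, map_add, hf, hg]
  | single x c => simp

lemma polyConjInv_eq_bar {s : Fin r → ℕ} (A : GArray s) : A.polyConjInv = bar r A.poly := by
  simp only [polyConjInv, poly, map_sum, bar_single]
  rfl

/-- The Laurent polynomial with coefficient `f i` at the exponent `φ i`, as a linear function of
the coefficients. Several indices may share an exponent. -/
noncomputable def genPoly {ι : Type*} [Fintype ι] (φ : ι → Fin r → ℤ) :
    (ι → ℂ) →ₗ[ℂ] LaurentPoly r where
  toFun f := ∑ i, AddMonoidAlgebra.single (φ i) (f i)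
  map_add' f g := by simp [AddMonoidAlgebra.single_add, Finset.sum_add_distrib]
  map_smul' c f := by simp [Finset.smul_sum, AddMonoidAlgebra.smul_single]

lemma genPoly_apply {ι : Type*} [Fintype ι] (φ : ι → Fin r → ℤ) (f : ι → ℂ) :
    genPoly φ f = ∑ i, AddMonoidAlgebra.single (φ i) (f i) := rfl

lemma genPoly_mul {ι κ : Type*} [Fintype ι] [Fintype κ] (φ : ι → Fin r → ℤ) (ψ : κ → Fin r → ℤ)
    (f : ι → ℂ) (g : κ → ℂ) :
    genPoly φ f * genPoly ψ g =
      genPoly (fun x : ι × κ => φ x.1 + ψ x.2) (fun x => f x.1 * g x.2) := by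
  simp only [genPoly_apply, Finset.sum_mul_sum, Fintype.sum_prod_type,
    AddMonoidAlgebra.single_mul_single]

/-- The exponent vector of an array index. -/
def pos {s : Fin r → ℕ} (i : ∀ k, Fin (s k)) : Fin r → ℤ := fun k => ((i k : ℕ) : ℤ)

lemma poly_comp_symm {s : Fin r → ℕ} {ι : Type*} [Fintype ι] (e : ι ≃ ∀ k, Fin (s k))
    (f : ι → ℂ) : poly (s := s) (f ∘ e.symm) = genPoly (fun i => pos (e i)) f := by
  rw [poly, genPoly_apply, ← e.sum_comp]
  simp
  rfl

/-! ### Golay sequences -/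

/-- Two sequences of Gaussian integers, all terms fourth roots of unity, whose aperiodic
autocorrelations add up to `2 * m` times the unit pulse. Gaussian integers make the condition
decidable. -/
structure IsGolay {m : ℕ} (F G : Fin m → GaussianInt) : Prop where
  pow_left : ∀ i, F i ^ 4 = 1
  pow_right : ∀ i, G i ^ 4 = 1
  autocorr : ∀ t ∈ Finset.Ioo (-(m : ℤ)) m,
    (∑ i : Fin m, ∑ j : Fin m,
      if (i : ℤ) - (j : ℤ) = t then F i * star (F j) + G i * star (G j) else 0) =
      if t = 0 then 2 * (m : GaussianInt) else 0

/-- A Golay pair of `±1` sequences with `A i * B i = -A (m - 1 - i) * B (m - 1 - i)`. (Every binary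
Golay pair of length at least two has this symmetry, but here it is part of the definition.) -/
structure IsSymmBinaryGolay {m : ℕ} (A B : Fin m → GaussianInt) : Prop where
  isGolay : IsGolay A B
  left : ∀ i, A i = 1 ∨ A i = -1
  right : ∀ i, B i = 1 ∨ B i = -1
  symm : ∀ i, A i * B i * A i.rev * B i.rev = -1

/-- The Laurent polynomial of a sequence laid out along the multiples of a vector `v`. -/
noncomputable def seqPoly {m : ℕ} (v : Fin r → ℤ) : (Fin m → ℂ) →ₗ[ℂ] LaurentPoly r :=
  genPoly (fun i : Fin m => ((i : ℕ) : ℤ) • v)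

lemma seqPoly_apply {m : ℕ} (v : Fin r → ℤ) (f : Fin m → ℂ) :
    seqPoly v f = ∑ i : Fin m, AddMonoidAlgebra.single (((i : ℕ) : ℤ) • v) (f i) := rfl

lemma bar_seqPoly {m : ℕ} (v : Fin r → ℤ) (f : Fin m → ℂ) :
    bar r (seqPoly v f) =
      ∑ i : Fin m, AddMonoidAlgebra.single (-(((i : ℕ) : ℤ) • v)) (starRingEnd ℂ (f i)) := by
  simp [seqPoly_apply]

lemma IsGolay.seqPoly_eq {m : ℕ} {F G : Fin m → GaussianInt} (h : IsGolay F G) (v : Fin r → ℤ) :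
    seqPoly v (fun i => (F i : ℂ)) * bar r (seqPoly v (fun i => (F i : ℂ))) +
      seqPoly v (fun i => (G i : ℂ)) * bar r (seqPoly v (fun i => (G i : ℂ))) =
      ((2 * m : ℕ) : LaurentPoly r) := by
  set c : Fin m × Fin m → ℂ := fun p =>
    ((F p.1 * star (F p.2) + G p.1 * star (G p.2) : GaussianInt) : ℂ) with hc
  set δ : Fin m × Fin m → ℤ := fun p => (p.1 : ℤ) - (p.2 : ℤ) with hδ
  have h1 : seqPoly v (fun i => (F i : ℂ)) * bar r (seqPoly v (fun i => (F i : ℂ))) +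
      seqPoly v (fun i => (G i : ℂ)) * bar r (seqPoly v (fun i => (G i : ℂ))) =
      ∑ p : Fin m × Fin m, AddMonoidAlgebra.single (δ p • v) (c p) := by
    rw [bar_seqPoly, bar_seqPoly]
    simp only [seqPoly_apply, Finset.sum_mul_sum, Fintype.sum_prod_type,
      AddMonoidAlgebra.single_mul_single, ← Finset.sum_add_distrib, ← AddMonoidAlgebra.single_add,
      hc, hδ, sub_eq_add_neg, add_smul, neg_smul, toComplex_add, toComplex_mul,
      toComplex_star]
  have hmaps : ∀ p ∈ (Finset.univ : Finset (Fin m × Fin m)), δ p ∈ Finset.Ioo (-(m : ℤ)) m := by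
    intro p _
    have := p.1.2
    have := p.2.2
    simp only [hδ, Finset.mem_Ioo]
    omega
  have hcoef : ∀ t ∈ Finset.Ioo (-(m : ℤ)) m,
      ∑ p with δ p = t, AddMonoidAlgebra.single (δ p • v) (c p) =
        if t = 0 then ((2 * m : ℕ) : LaurentPoly r) else 0 := by
    intro t ht
    have hs : ∑ p with δ p = t, c p = if t = 0 then 2 * (m : ℂ) else 0 := by
      have := congrArg toComplex (h.autocorr t ht)
      rw [Finset.sum_filter, Fintype.sum_prod_type]
      simp only [map_sum, apply_ite toComplex, map_zero, map_mul, map_natCast, map_ofNat] at this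
      exact this
    have : ∑ p with δ p = t, AddMonoidAlgebra.single (δ p • v) (c p) =
        AddMonoidAlgebra.single (t • v) (∑ p with δ p = t, c p) := by
      rw [← AddMonoidAlgebra.singleAddHom_apply, map_sum]
      refine Finset.sum_congr rfl fun p hp => ?_
      rw [(Finset.mem_filter.1 hp).2]
      rfl
    rw [this, hs]
    split_ifs with h0
    · subst h0
      rw [zero_smul, ← map_natCast (AddMonoidAlgebra.singleZeroRingHom (R := ℂ) (M := Fin r → ℤ))]
      simp
    · simp
  have hm : m = 0 ∨ (0 : ℤ) ∈ Finset.Ioo (-(m : ℤ)) m := by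
    simp only [Finset.mem_Ioo]
    omega
  rw [h1, ← Finset.sum_fiberwise_of_maps_to hmaps, Finset.sum_congr rfl hcoef]
  rcases hm with rfl | hm
  · simp
  · simp [Finset.sum_ite_eq', hm]

/-- The reversed and conjugated sequence. -/
noncomputable def revConj {m : ℕ} (f : Fin m → ℂ) : Fin m → ℂ := fun i => starRingEnd ℂ (f i.rev)

/-- Reversing and conjugating a sequence conjugates its polynomial, up to a monomial. -/
lemma seqPoly_rev {m : ℕ} (v : Fin r → ℤ) (f : Fin m → ℂ) :
    seqPoly v (revConj f) =
      AddMonoidAlgebra.single (((m : ℤ) - 1) • v) 1 * bar r (seqPoly v f) := by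
  rw [bar_seqPoly, seqPoly_apply, Finset.mul_sum, ← Equiv.sum_comp Fin.revPerm]
  refine Finset.sum_congr rfl fun i _ => ?_
  rw [AddMonoidAlgebra.single_mul_single, one_mul, Fin.revPerm_apply, revConj, Fin.rev_rev,
    ← neg_smul, ← add_smul]
  congr 2
  rw [Fin.val_rev]
  have := i.2
  omega

lemma isSymmBinaryGolay_two : IsSymmBinaryGolay ![1, 1] ![1, -1] := by
  refine ⟨⟨?_, ?_, ?_⟩, ?_, ?_, ?_⟩ <;> decide +kernel

lemma isSymmBinaryGolay_ten : IsSymmBinaryGolay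
    ![1, 1, 1, 1, 1, -1, 1, -1, -1, 1] ![1, 1, -1, -1, 1, 1, 1, -1, 1, -1] := by
  refine ⟨⟨?_, ?_, ?_⟩, ?_, ?_, ?_⟩ <;> decide +kernel

lemma isSymmBinaryGolay_twentySix : IsSymmBinaryGolay
    ![1, 1, 1, 1, -1, 1, 1, -1, -1, 1, -1, 1, -1, 1, -1, -1, 1, -1, 1, 1, 1, -1, -1, 1, 1, 1]
    ![1, 1, 1, 1, -1, 1, 1, -1, -1, 1, -1, 1, 1, 1, 1, 1, -1, 1, -1, -1, -1, 1, 1, -1, -1,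
      -1] := by
  refine ⟨⟨?_, ?_, ?_⟩, ?_, ?_, ?_⟩ <;> decide +kernel

lemma isGolay_one : IsGolay ![1] ![1] := by
  refine ⟨?_, ?_, ?_⟩ <;> decide +kernel

lemma isGolay_three : IsGolay ![1, 1, -1] ![1, ⟨0, 1⟩, 1] := by
  refine ⟨?_, ?_, ?_⟩ <;> decide +kernel

lemma isGolay_five : IsGolay ![1, 1, 1, ⟨0, 1⟩, ⟨0, -1⟩] ![1, ⟨0, 1⟩, ⟨0, -1⟩, -1, ⟨0, 1⟩] := by
  refine ⟨?_, ?_, ?_⟩ <;> decide +kernel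

lemma isGolay_eleven : IsGolay
    ![1, ⟨0, 1⟩, -1, 1, -1, ⟨0, 1⟩, ⟨0, -1⟩, -1, ⟨0, 1⟩, ⟨0, 1⟩, 1]
    ![1, 1, ⟨0, -1⟩, ⟨0, -1⟩, ⟨0, -1⟩, 1, 1, ⟨0, 1⟩, -1, 1, -1] := by
  refine ⟨?_, ?_, ?_⟩ <;> decide +kernel

lemma isGolay_thirteen : IsGolay
    ![1, 1, 1, ⟨0, 1⟩, -1, 1, 1, ⟨0, -1⟩, 1, -1, 1, ⟨0, -1⟩, ⟨0, 1⟩]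
    ![1, ⟨0, 1⟩, -1, -1, -1, ⟨0, 1⟩, -1, 1, 1, ⟨0, -1⟩, -1, 1, ⟨0, -1⟩] := by
  refine ⟨?_, ?_, ?_⟩ <;> decide +kernel

/-! ### The product construction -/

/-- If `(A, B)` is a Golay pair, the matrix `N` with rows
`q (A + B - w A' + w B'), q (A - B + w A' + w B')` and
`q (A + B + w A' - w B'), q (A - B - w A' - w B')` is paraunitary, so multiplying the row `(C, D)`
of another Golay pair by `N` preserves the Golay identity. Primes stand for the involution, and
`w A'`, `w B'` are the reversed sequences. -/
lemma paraunitary_step {R : Type*} [CommRing R] {C C' D D' A A' B B' w w' q n₁ n₂ : R}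
    (hC : C * C' + D * D' = n₁) (hA : A * A' + B * B' = n₂) (hw : w * w' = 1) (hq : 4 * q = 1) :
    (C * (q * (A + B - w * A' + w * B')) + D * (q * (A + B + w * A' - w * B'))) *
        (C' * (q * (A' + B' - w' * A + w' * B)) + D' * (q * (A' + B' + w' * A - w' * B))) +
      (C * (q * (A - B + w * A' + w * B')) + D * (q * (A - B - w * A' - w * B'))) *
        (C' * (q * (A' - B' + w' * A + w' * B)) + D' * (q * (A' - B' - w' * A - w' * B))) =
      q * n₁ * n₂ := by
  have h1 : (q * (A + B - w * A' + w * B')) * (q * (A' + B' - w' * A + w' * B)) +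
      (q * (A - B + w * A' + w * B')) * (q * (A' - B' + w' * A + w' * B)) = q * n₂ := by
    linear_combination 2 * q ^ 2 * (1 + w * w') * hA + 2 * q ^ 2 * n₂ * hw + q * n₂ * hq
  have h2 : (q * (A + B + w * A' - w * B')) * (q * (A' + B' + w' * A - w' * B)) +
      (q * (A - B - w * A' - w * B')) * (q * (A' - B' - w' * A - w' * B)) = q * n₂ := by
    linear_combination 2 * q ^ 2 * (1 + w * w') * hA + 2 * q ^ 2 * n₂ * hw + q * n₂ * hq
  have h3 : (q * (A + B - w * A' + w * B')) * (q * (A' + B' + w' * A - w' * B)) +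
      (q * (A - B + w * A' + w * B')) * (q * (A' - B' - w' * A - w' * B)) = 0 := by
    linear_combination -2 * q ^ 2 * (A * A' + B * B') * hw
  have h4 : (q * (A + B + w * A' - w * B')) * (q * (A' + B' - w' * A + w' * B)) +
      (q * (A - B - w * A' - w * B')) * (q * (A' - B' + w' * A + w' * B)) = 0 := by
    linear_combination -2 * q ^ 2 * (A * A' + B * B') * hw
  linear_combination C * C' * h1 + D * D' * h2 + C * D' * h3 + D * C' * h4 + q * n₂ * hC

/-- Multiplication of the row `(X, Y)` by the paraunitary matrix with rows `E, F` and
`-y F', y E'`. -/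
lemma pair_mul_pair {R : Type*} [CommRing R] {X X' Y Y' E E' F F' y y' n₁ n₂ : R}
    (hX : X * X' + Y * Y' = n₁) (hE : E * E' + F * F' = n₂) (hy : y * y' = 1) :
    (X * E - Y * (y * F')) * (X' * E' - Y' * (y' * F)) +
      (X * F + Y * (y * E')) * (X' * F' + Y' * (y' * E)) = n₁ * n₂ := by
  linear_combination n₂ * hX + (X * X' + Y * Y') * hE + Y * Y' * (E * E' + F * F') * hy

/-- The two paraunitary multiplications combined, for an abstract involution `σ`: `(X, Y)` is the
row `(C, D) N`, and `(P, Q)` is the row of the resulting Golay pair. -/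
lemma golay_product {R : Type*} [CommRing R] (σ : R →+* R) (hσ : ∀ x, σ (σ x) = x)
    {A B C D E F P Q X Y w y q n₁ n₂ n₃ : R} (hσq : σ q = q) (hq : 4 * q = 1)
    (hw : w * σ w = 1) (hy : y * σ y = 1) (hC : C * σ C + D * σ D = n₁)
    (hA : A * σ A + B * σ B = n₂) (hE : E * σ E + F * σ F = n₃)
    (hX : X = C * (q * (A + B - w * σ A + w * σ B)) + D * (q * (A + B + w * σ A - w * σ B)))
    (hY : Y = C * (q * (A - B + w * σ A + w * σ B)) + D * (q * (A - B - w * σ A - w * σ B)))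
    (hP : P = X * E - Y * (y * σ F)) (hQ : Q = X * F + Y * (y * σ E)) :
    P * σ P + Q * σ Q = q * n₁ * n₂ * n₃ := by
  have hXY : X * σ X + Y * σ Y = q * n₁ * n₂ := by
    rw [hX, hY]
    simpa only [map_add, map_sub, map_mul, hσ, hσq] using paraunitary_step hC hA hw hq
  rw [hP, hQ]
  simpa only [map_add, map_sub, map_mul, hσ] using pair_mul_pair hXY hE hy

/-- Appending a digit with `m` values to the mixed radix expansion in direction `l`. -/
lemma exists_equiv_mul_mulSingle (t : Fin r → ℕ) (l : Fin r) (m : ℕ) :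
    ∃ e : (∀ k, Fin (t k)) × Fin m ≃ ∀ k, Fin ((t * Pi.mulSingle l m : Fin r → ℕ) k),
      ∀ x, pos (e x) = pos x.1 + ((x.2 : ℕ) : ℤ) • (Pi.single l (t l : ℤ) : Fin r → ℤ) := by
  have hlt : ∀ (x : (∀ k, Fin (t k)) × Fin m) (k : Fin r),
      (x.1 k : ℕ) + (if k = l then x.2 * t l else 0) <
        (t * Pi.mulSingle l m : Fin r → ℕ) k := by
    intro x k
    have h1 := (x.1 k).2
    by_cases hk : k = l
    · subst hk
      have h2 : (x.2 : ℕ) + 1 ≤ m := x.2.2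
      have := Nat.mul_le_mul_right (t k) h2
      simp only [if_true, Pi.mul_apply, Pi.mulSingle_eq_same]
      nlinarith
    · simp [hk]
  let f : (∀ k, Fin (t k)) × Fin m → ∀ k, Fin ((t * Pi.mulSingle l m : Fin r → ℕ) k) :=
    fun x k => ⟨_, hlt x k⟩
  have hinj : Function.Injective f := by
    intro x y hxy
    have h : ∀ k, (x.1 k : ℕ) + (if k = l then x.2 * t l else 0) =
        (y.1 k : ℕ) + (if k = l then y.2 * t l else 0) :=
      fun k => congrArg Fin.val (congrFun hxy k)
    have hl := h l
    simp only [if_true] at hl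
    have hpos : 0 < t l := (x.1 l).pos
    have h2 : (x.2 : ℕ) = y.2 := by
      have := congrArg (· / t l) hl
      simpa [Nat.add_mul_div_right _ _ hpos, Nat.div_eq_of_lt (x.1 l).2,
        Nat.div_eq_of_lt (y.1 l).2] using this
    refine Prod.ext (funext fun k => Fin.ext ?_) (Fin.ext h2)
    have := h k
    rw [h2] at this
    exact Nat.add_right_cancel this
  have hbij : Function.Bijective f := by
    rw [Fintype.bijective_iff_injective_and_card]
    refine ⟨hinj, ?_⟩
    simp [Finset.prod_mul_distrib, Finset.prod_pi_mulSingle']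
  refine ⟨Equiv.ofBijective f hbij, fun x => funext fun k => ?_⟩
  by_cases hk : k = l
  · subst hk
    simp [pos, f]
  · simp [pos, f, hk]

/-- There is a quaternary GCA pair of size `t`; being a fourth root of unity is expressed by
`x ^ 4 = 1`, and the constant in the Golay identity is given explicitly. -/
def HasPair (t : Fin r → ℕ) : Prop :=
  ∃ A B : GArray t, (∀ i, A i ^ 4 = 1) ∧ (∀ i, B i ^ 4 = 1) ∧
    A.poly * bar r A.poly + B.poly * bar r B.poly = ((2 * ∏ k, t k : ℕ) : LaurentPoly r)

lemma eq_one_or_of_pow_four {x : ℂ} (h : x ^ 4 = 1) :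
    x = 1 ∨ x = -1 ∨ x = Complex.I ∨ x = -Complex.I := by
  have : (x - 1) * ((x + 1) * ((x - Complex.I) * (x + Complex.I))) = 0 := by
    linear_combination h - (x ^ 2 - 1) * Complex.I_sq
  simpa [sub_eq_zero, add_eq_zero_iff_eq_neg] using this

lemma norm_eq_one_of_pow_four {x : ℂ} (h : x ^ 4 = 1) : ‖x‖ = 1 :=
  Complex.norm_eq_one_of_pow_eq_one h (by norm_num)

lemma HasPair.exists_isQuaternaryGCAPair {t : Fin r → ℕ} (h : HasPair t) :
    ∃ A B : GArray t, IsQuaternaryGCAPair A B := by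
  obtain ⟨A, B, hA, hB, hAB⟩ := h
  refine ⟨A, B, fun i => eq_one_or_of_pow_four (hA i), fun i => eq_one_or_of_pow_four (hB i),
    ?_, ?_⟩
  · intro l i
    right
    fin_cases l
    · exact norm_eq_one_of_pow_four (hA i)
    · exact norm_eq_one_of_pow_four (hB i)
  · have hwA : A.weight = ∏ k, (t k : ℝ) := by
      simp [weight, norm_eq_one_of_pow_four (hA _)]
    have hwB : B.weight = ∏ k, (t k : ℝ) := by
      simp [weight, norm_eq_one_of_pow_four (hB _)]
    rw [Fin.sum_univ_two, Fin.sum_univ_two]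
    simp only [Matrix.cons_val_zero, Matrix.cons_val_one, polyConjInv_eq_bar, hAB, hwA, hwB]
    rw [← map_natCast (AddMonoidAlgebra.singleZeroRingHom (R := ℂ) (M := Fin r → ℤ))]
    simp [two_mul]

lemma pos_eq_zero (i : ∀ k, Fin ((1 : Fin r → ℕ) k)) : pos i = 0 := by
  funext k
  have : (i k : ℕ) < 1 := (i k).2
  simp only [pos, Pi.zero_apply]
  omega

lemma hasPair_one : HasPair (1 : Fin r → ℕ) := by
  have h1 : poly (s := (1 : Fin r → ℕ)) (fun _ => 1) = 1 := by
    have : poly (s := (1 : Fin r → ℕ)) (fun _ => 1) =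
        ∑ i : (∀ k, Fin ((1 : Fin r → ℕ) k)), AddMonoidAlgebra.single (pos i) (1 : ℂ) := rfl
    rw [this]
    simp only [pos_eq_zero]
    simp [AddMonoidAlgebra.one_def]
  refine ⟨fun _ => 1, fun _ => 1, by simp, by simp, ?_⟩
  rw [h1]
  simp
  norm_num

lemma IsGolay.hasPair {m : ℕ} {F G : Fin m → GaussianInt} (h : IsGolay F G) (l : Fin r) :
    HasPair (Pi.mulSingle l m : Fin r → ℕ) := by
  obtain ⟨e, he⟩ := exists_equiv_mul_mulSingle (1 : Fin r → ℕ) l m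
  rw [← one_mul (Pi.mulSingle l m : Fin r → ℕ)]
  have key : ∀ f : Fin m → ℂ,
      poly (s := 1 * Pi.mulSingle l m) ((fun x => f x.2) ∘ e.symm) =
        seqPoly (Pi.single l 1) f := by
    intro f
    rw [poly_comp_symm, genPoly_apply, Fintype.sum_prod_type]
    simp [he, pos_eq_zero, seqPoly_apply]
  refine ⟨(fun x => (F x.2 : ℂ)) ∘ e.symm, (fun x => (G x.2 : ℂ)) ∘ e.symm, ?_, ?_, ?_⟩
  · intro i
    simp only [Function.comp, ← map_pow, h.pow_left, map_one]
  · intro i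
    simp only [Function.comp, ← map_pow, h.pow_right, map_one]
  · rw [key fun i => (F i : ℂ), key fun i => (G i : ℂ), h.seqPoly_eq]
    simp [Finset.prod_pi_mulSingle']

/-- The four combinations of `a`, `b` and the reversed signs `a'`, `b'` below are `±1` for exactly
one of the four and vanish for the others, so every entry is a product of fourth roots of unity. -/
lemma pow_four_combination {a b a' b' : ℂ} (ha : a = 1 ∨ a = -1) (hb : b = 1 ∨ b = -1)
    (ha' : a' = 1 ∨ a' = -1) (hs : a * b * a' * b' = -1) {x₁ x₂ x₃ x₄ : ℂ}
    (h₁ : x₁ ^ 4 = 1) (h₂ : x₂ ^ 4 = 1) (h₃ : x₃ ^ 4 = 1) (h₄ : x₄ ^ 4 = 1) :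
    ((1 / 4) * (a + b - a' + b') * x₁ + (1 / 4) * (a + b + a' - b') * x₂ +
      (1 / 4) * (a - b + a' + b') * x₃ + (1 / 4) * (a - b - a' - b') * x₄) ^ 4 = 1 := by
  have hb' : b' = -(a * b * a') := by
    rcases ha with rfl | rfl <;> rcases hb with rfl | rfl <;> rcases ha' with rfl | rfl <;> grind
  subst hb'
  rcases ha with rfl | rfl <;> rcases hb with rfl | rfl <;> rcases ha' with rfl | rfl <;>
    norm_num [mul_pow, h₁, h₂, h₃, h₄]

/-- The coefficient `(C N₁₁ + D N₂₁) F + (C N₁₂ + D N₂₂) G`, where the three kinds of factors depend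
on three independent indices. -/
noncomputable def productCoeff {ι κ μ : Type*} (C D : ι → ℂ) (n₁₁ n₂₁ n₁₂ n₂₂ : κ → ℂ)
    (f g : μ → ℂ) (x : (ι × κ) × μ) : ℂ :=
  C x.1.1 * n₁₁ x.1.2 * f x.2 + D x.1.1 * n₂₁ x.1.2 * f x.2 +
    (C x.1.1 * n₁₂ x.1.2 * g x.2 + D x.1.1 * n₂₂ x.1.2 * g x.2)

lemma poly_productCoeff {t s : Fin r → ℕ} {g m : ℕ} {v₁ v₂ : Fin r → ℤ}
    (e : ((∀ k, Fin (t k)) × Fin g) × Fin m ≃ ∀ k, Fin (s k))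
    (he : ∀ x, pos (e x) = pos x.1.1 + ((x.1.2 : ℕ) : ℤ) • v₁ + ((x.2 : ℕ) : ℤ) • v₂)
    (C D : GArray t) (n₁₁ n₂₁ n₁₂ n₂₂ : Fin g → ℂ) (f₁ f₂ : Fin m → ℂ) :
    poly (s := s) (productCoeff C D n₁₁ n₂₁ n₁₂ n₂₂ f₁ f₂ ∘ e.symm) =
      (C.poly * seqPoly v₁ n₁₁ + D.poly * seqPoly v₁ n₂₁) * seqPoly v₂ f₁ +
        (C.poly * seqPoly v₁ n₁₂ + D.poly * seqPoly v₁ n₂₂) * seqPoly v₂ f₂ := by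
  have hprod : ∀ (f₁ : GArray t) (f₂ : Fin g → ℂ) (f₃ : Fin m → ℂ),
      f₁.poly * seqPoly v₁ f₂ * seqPoly v₂ f₃ =
        genPoly (fun x => pos (e x)) (fun x => f₁ x.1.1 * f₂ x.1.2 * f₃ x.2) := by
    intro f₁ f₂ f₃
    have : f₁.poly = genPoly pos f₁ := rfl
    rw [this, seqPoly, seqPoly, genPoly_mul, genPoly_mul]
    simp only [he]
  rw [poly_comp_symm, add_mul, add_mul, hprod, hprod, hprod, hprod, ← map_add, ← map_add,
    ← map_add]
  rfl

lemma IsSymmBinaryGolay.productCoeff_pow_four {g : ℕ} {A B : Fin g → GaussianInt}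
    (hAB : IsSymmBinaryGolay A B) {ι μ : Type*} {C D : ι → ℂ} {f₁ f₂ : μ → ℂ}
    (hC : ∀ i, C i ^ 4 = 1) (hD : ∀ i, D i ^ 4 = 1) (hf₁ : ∀ i, f₁ i ^ 4 = 1)
    (hf₂ : ∀ i, f₂ i ^ 4 = 1) {a b n₁₁ n₂₁ n₁₂ n₂₂ : Fin g → ℂ}
    (ha : a = fun i => (A i : ℂ)) (hb : b = fun i => (B i : ℂ))
    (h₁₁ : n₁₁ = (1 / 4 : ℂ) • (a + b - revConj a + revConj b))
    (h₂₁ : n₂₁ = (1 / 4 : ℂ) • (a + b + revConj a - revConj b))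
    (h₁₂ : n₁₂ = (1 / 4 : ℂ) • (a - b + revConj a + revConj b))
    (h₂₂ : n₂₂ = (1 / 4 : ℂ) • (a - b - revConj a - revConj b)) (x : (ι × Fin g) × μ) :
    productCoeff C D n₁₁ n₂₁ n₁₂ n₂₂ f₁ f₂ x ^ 4 = 1 := by
  have ha1 : ∀ i, a i = 1 ∨ a i = -1 := fun i => by
    rcases hAB.left i with h | h <;> simp [ha, h]
  have hb1 : ∀ i, b i = 1 ∨ b i = -1 := fun i => by
    rcases hAB.right i with h | h <;> simp [hb, h]
  have ha' : ∀ i, revConj a i = a i.rev := fun i => by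
    rcases ha1 i.rev with h | h <;> simp [revConj, h]
  have hb' : ∀ i, revConj b i = b i.rev := fun i => by
    rcases hb1 i.rev with h | h <;> simp [revConj, h]
  have hs : a x.1.2 * b x.1.2 * revConj a x.1.2 * revConj b x.1.2 = -1 := by
    rw [ha', hb']
    simpa [ha, hb] using congrArg toComplex (hAB.symm x.1.2)
  have key := pow_four_combination (ha1 x.1.2) (hb1 x.1.2)
    (by rw [ha']; exact ha1 x.1.2.rev) hs
    (x₁ := C x.1.1 * f₁ x.2) (x₂ := D x.1.1 * f₁ x.2) (x₃ := C x.1.1 * f₂ x.2)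
    (x₄ := D x.1.1 * f₂ x.2) (by rw [mul_pow, hC, hf₁, one_mul]) (by rw [mul_pow, hD, hf₁, one_mul])
    (by rw [mul_pow, hC, hf₂, one_mul]) (by rw [mul_pow, hD, hf₂, one_mul])
  rw [← key]
  congr 1
  simp only [productCoeff, h₁₁, h₂₁, h₁₂, h₂₂, Pi.smul_apply, Pi.add_apply, Pi.sub_apply,
    smul_eq_mul]
  ring

/-- A quaternary pair of size `t`, a symmetric binary Golay pair of length `g` and a Golay pair of
length `m` combine to a quaternary pair of size `t * g * m`, with `g` and `m` put into arbitrary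
dimensions. The new polynomials are `X E - Y F*` and `X F + Y E*`, where `(X, Y) = (C, D) N` and
`*` is reversal and conjugation. The four entries of `N` have disjoint supports covering
`0, …, g - 1`, which keeps the new entries fourth roots of unity. -/
lemma HasPair.mul {t : Fin r → ℕ} (h : HasPair t) {g m : ℕ} {A B : Fin g → GaussianInt}
    (hAB : IsSymmBinaryGolay A B) {E F : Fin m → GaussianInt} (hEF : IsGolay E F) (k l : Fin r) :
    HasPair (t * Pi.mulSingle k g * Pi.mulSingle l m) := by
  obtain ⟨C, D, hC, hD, hCD⟩ := h
  obtain ⟨e₁, he₁⟩ := exists_equiv_mul_mulSingle t k g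
  obtain ⟨e₂, he₂⟩ := exists_equiv_mul_mulSingle (t * Pi.mulSingle k g) l m
  -- Only the shape of the exponents matters below, not the vectors `v₁` and `v₂` themselves.
  generalize (Pi.single k (t k : ℤ) : Fin r → ℤ) = v₁ at he₁
  generalize (Pi.single l (((t * Pi.mulSingle k g : Fin r → ℕ) l : ℕ) : ℤ) : Fin r → ℤ) =
    v₂ at he₂
  obtain ⟨e, he⟩ : ∃ e : ((∀ k, Fin (t k)) × Fin g) × Fin m ≃
      ∀ i, Fin ((t * Pi.mulSingle k g * Pi.mulSingle l m : Fin r → ℕ) i),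
      ∀ x, pos (e x) = pos x.1.1 + ((x.1.2 : ℕ) : ℤ) • v₁ + ((x.2 : ℕ) : ℤ) • v₂ :=
    ⟨(e₁.prodCongr (Equiv.refl (Fin m))).trans e₂, fun x => by simp [he₁, he₂]⟩
  have hgA := hAB.isGolay.seqPoly_eq v₁
  have hgE := hEF.seqPoly_eq v₂
  obtain ⟨a, ha⟩ : ∃ a : Fin g → ℂ, a = fun i => (A i : ℂ) := ⟨_, rfl⟩
  obtain ⟨b, hb⟩ : ∃ b : Fin g → ℂ, b = fun i => (B i : ℂ) := ⟨_, rfl⟩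
  obtain ⟨c, hc⟩ : ∃ c : Fin m → ℂ, c = fun i => (E i : ℂ) := ⟨_, rfl⟩
  obtain ⟨d, hd⟩ : ∃ d : Fin m → ℂ, d = fun i => (F i : ℂ) := ⟨_, rfl⟩
  rw [← ha, ← hb] at hgA
  rw [← hc, ← hd] at hgE
  have hc4 : ∀ i, c i ^ 4 = 1 := fun i => by simp only [hc, ← map_pow, hEF.pow_left, map_one]
  have hd4 : ∀ i, d i ^ 4 = 1 := fun i => by simp only [hd, ← map_pow, hEF.pow_right, map_one]
  have hc4' : ∀ i, revConj c i ^ 4 = 1 := fun i => by simp only [revConj, ← map_pow, hc4, map_one]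
  have hd4' : ∀ i, (-revConj d) i ^ 4 = 1 := fun i => by
    rw [Pi.neg_apply, Even.neg_pow (by decide)]
    simp only [revConj, ← map_pow, hd4, map_one]
  obtain ⟨n₁₁, h₁₁⟩ : ∃ n, n = (1 / 4 : ℂ) • (a + b - revConj a + revConj b) := ⟨_, rfl⟩
  obtain ⟨n₂₁, h₂₁⟩ : ∃ n, n = (1 / 4 : ℂ) • (a + b + revConj a - revConj b) := ⟨_, rfl⟩
  obtain ⟨n₁₂, h₁₂⟩ : ∃ n, n = (1 / 4 : ℂ) • (a - b + revConj a + revConj b) := ⟨_, rfl⟩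
  obtain ⟨n₂₂, h₂₂⟩ : ∃ n, n = (1 / 4 : ℂ) • (a - b - revConj a - revConj b) := ⟨_, rfl⟩
  have hmono : ∀ x : Fin r → ℤ, (AddMonoidAlgebra.single x 1 : LaurentPoly r) *
      bar r (AddMonoidAlgebra.single x 1) = 1 := by
    intro x
    rw [bar_single, AddMonoidAlgebra.single_mul_single, add_neg_cancel, map_one, mul_one]
    rfl
  obtain ⟨q, hq⟩ : ∃ q : LaurentPoly r, q = algebraMap ℂ _ (1 / 4) := ⟨_, rfl⟩
  have hq4 : 4 * q = 1 := by
    rw [hq, ← map_ofNat (algebraMap ℂ (LaurentPoly r)) 4, ← map_mul,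
      show (4 : ℂ) * (1 / 4) = 1 by norm_num, map_one]
  have hqbar : bar r q = q := by
    rw [hq, AddMonoidAlgebra.coe_algebraMap]
    simp [Complex.conj_ofNat]
  have hconst : q * ((2 * ∏ k, t k : ℕ) : LaurentPoly r) * ((2 * g : ℕ) : LaurentPoly r) *
      ((2 * m : ℕ) : LaurentPoly r) =
      ((2 * ∏ i, (t * Pi.mulSingle k g * Pi.mulSingle l m : Fin r → ℕ) i : ℕ) :
        LaurentPoly r) := by
    simp only [Pi.mul_apply, Finset.prod_mul_distrib, Finset.prod_pi_mulSingle',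
      Finset.mem_univ, if_true]
    push_cast
    linear_combination 2 * (∏ k, (t k : LaurentPoly r)) * g * m * hq4
  refine ⟨productCoeff C D n₁₁ n₂₁ n₁₂ n₂₂ c (-revConj d) ∘ e.symm,
    productCoeff C D n₁₁ n₂₁ n₁₂ n₂₂ d (revConj c) ∘ e.symm,
    fun i => hAB.productCoeff_pow_four hC hD hc4 hd4' ha hb h₁₁ h₂₁ h₁₂ h₂₂ _,
    fun i => hAB.productCoeff_pow_four hC hD hd4 hc4' ha hb h₁₁ h₂₁ h₁₂ h₂₂ _, ?_⟩
  rw [poly_productCoeff e he, poly_productCoeff e he, ← hconst]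
  refine golay_product (bar r) bar_bar hqbar hq4 (hmono (((g : ℤ) - 1) • v₁))
    (hmono (((m : ℤ) - 1) • v₂)) hCD hgA hgE
    (X := C.poly * seqPoly v₁ n₁₁ + D.poly * seqPoly v₁ n₂₁)
    (Y := C.poly * seqPoly v₁ n₁₂ + D.poly * seqPoly v₁ n₂₂) ?_ ?_ ?_ ?_
  · simp only [h₁₁, h₂₁, map_smul, map_add, map_sub, seqPoly_rev, hq,
      Algebra.smul_def (A := LaurentPoly r)]
  · simp only [h₁₂, h₂₂, map_smul, map_add, map_sub, seqPoly_rev, hq,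
      Algebra.smul_def (A := LaurentPoly r)]
  · rw [map_neg, seqPoly_rev, mul_neg, ← sub_eq_add_neg]
  · rw [seqPoly_rev]

/-! ### Distributing the factors over the dimensions -/

/-- The size of an array whose factors are placed as listed: `(k, n)` puts a factor `n` into
dimension `k`. -/
def dims (L : List (Fin r × ℕ)) : Fin r → ℕ :=
  (L.map fun x => (Pi.mulSingle x.1 x.2 : Fin r → ℕ)).prod

lemma dims_nil : dims ([] : List (Fin r × ℕ)) = 1 := rfl

lemma dims_cons (x : Fin r × ℕ) (L : List (Fin r × ℕ)) :
    dims (x :: L) = Pi.mulSingle x.1 x.2 * dims L := by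
  simp [dims]

lemma dims_append (L M : List (Fin r × ℕ)) : dims (L ++ M) = dims L * dims M := by
  simp [dims]

lemma dims_replicate (n : ℕ) (x : Fin r × ℕ) :
    dims (List.replicate n x) = Pi.mulSingle x.1 (x.2 ^ n) := by
  simp [dims, Pi.mulSingle_pow]

/-- Each even factor lets one further odd factor be absorbed, and one odd factor is free. -/
lemma hasPair_dims (L : List (Fin r × ℕ)) :
    ∀ M : List (Fin r × ℕ), (∀ x ∈ L, x.2 = 2 ∨ x.2 = 10 ∨ x.2 = 26) →
      (∀ x ∈ M, x.2 = 3 ∨ x.2 = 5 ∨ x.2 = 11 ∨ x.2 = 13) → M.length ≤ L.length + 1 →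
      HasPair (dims L * dims M) := by
  have hodd : ∀ {m : ℕ}, m = 3 ∨ m = 5 ∨ m = 11 ∨ m = 13 →
      ∃ E F : Fin m → GaussianInt, IsGolay E F := by
    rintro m (rfl | rfl | rfl | rfl)
    exacts [⟨_, _, isGolay_three⟩, ⟨_, _, isGolay_five⟩, ⟨_, _, isGolay_eleven⟩,
      ⟨_, _, isGolay_thirteen⟩]
  have heven : ∀ {m : ℕ}, m = 2 ∨ m = 10 ∨ m = 26 →
      ∃ A B : Fin m → GaussianInt, IsSymmBinaryGolay A B := by
    rintro m (rfl | rfl | rfl)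
    exacts [⟨_, _, isSymmBinaryGolay_two⟩, ⟨_, _, isSymmBinaryGolay_ten⟩,
      ⟨_, _, isSymmBinaryGolay_twentySix⟩]
  induction L with
  | nil =>
    intro M _ hM hlen
    match M, hM, hlen with
    | [], _, _ => simpa [dims_nil] using hasPair_one
    | [x], hM, _ =>
      obtain ⟨E, F, hEF⟩ := hodd (hM x (by simp))
      simpa [dims_nil, dims_cons] using hEF.hasPair x.1
    | _ :: _ :: _, _, hlen => simp at hlen
  | cons x L ih =>
    intro M hL hM hlen
    obtain ⟨A, B, hAB⟩ := heven (hL x (by simp))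
    have hL' : ∀ x ∈ L, x.2 = 2 ∨ x.2 = 10 ∨ x.2 = 26 := fun y hy => hL y (by simp [hy])
    match M, hM, hlen with
    | [], hM, _ =>
      -- With no odd factor left, the even factor is used with the trivial pair of length `1`.
      have := (ih [] hL' hM (by simp)).mul (m := 1) hAB isGolay_one x.1 x.1
      rw [Pi.mulSingle_one, mul_one, mul_right_comm] at this
      rwa [dims_cons, mul_comm _ (dims L)]
    | y :: M, hM, hlen =>
      obtain ⟨E, F, hEF⟩ := hodd (hM y (by simp))
      have := (ih M hL' (fun z hz => hM z (by simp [hz])) (by simpa using hlen)).mul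
        hAB hEF x.1 y.1
      rw [dims_cons, dims_cons]
      convert this using 1
      ring

/-- A factorization into primes of the number of entries distributes over the dimensions. -/
lemma exists_dims_eq (P : List ℕ) : ∀ s : Fin r → ℕ, (∀ p ∈ P, p.Prime) → ∏ k, s k = P.prod →
    ∃ L : List (Fin r × ℕ), L.map Prod.snd = P ∧ dims L = s := by
  induction P with
  | nil =>
    intro s _ hs
    refine ⟨[], rfl, ?_⟩
    rw [List.prod_nil, Finset.prod_eq_one_iff] at hs
    exact funext fun k => (hs k (Finset.mem_univ k)).symm
  | cons p P ih =>
    intro s hP hs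
    have hp : p.Prime := hP p (by simp)
    obtain ⟨k, -, n, hn⟩ := (hp.prime.dvd_finsetProd_iff s).1
      ⟨P.prod, by rw [hs, List.prod_cons]⟩
    have hs' : s = Pi.mulSingle k p * Function.update s k n := by
      funext i
      by_cases hi : i = k
      · subst hi
        simpa using hn
      · simp [hi]
    have hprod : ∏ i, Function.update s k n i = P.prod := by
      have : ∏ i, s i = p * ∏ i, Function.update s k n i := by
        conv_lhs => rw [hs']
        simp [Finset.prod_mul_distrib, Finset.prod_pi_mulSingle']
      rw [this, List.prod_cons] at hs
      exact Nat.eq_of_mul_eq_mul_left hp.pos hs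
    obtain ⟨L, hL, hLs⟩ := ih _ (fun q hq => hP q (by simp [hq])) hprod
    exact ⟨(k, p) :: L, by simp [hL], by rw [dims_cons, hLs]; exact hs'.symm⟩

lemma exists_dims_ten_twentySix (p q : Fin r → ℕ) (S : Finset (Fin r)) :
    ∃ L : List (Fin r × ℕ), L.length = ∑ k ∈ S, (p k + q k) ∧ (∀ x ∈ L, x.2 = 10 ∨ x.2 = 26) ∧
      dims L = ∏ k ∈ S, Pi.mulSingle k (10 ^ p k * 26 ^ q k) := by
  induction S using Finset.induction_on with
  | empty => exact ⟨[], by simp, by simp, by simp [dims_nil]⟩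
  | insert k S hk ih =>
    obtain ⟨L, h1, h2, h3⟩ := ih
    refine ⟨List.replicate (p k) (k, 10) ++ List.replicate (q k) (k, 26) ++ L, ?_, ?_, ?_⟩
    · simp [Finset.sum_insert hk, h1, add_assoc]
    · intro x hx
      simp only [List.mem_append, List.mem_replicate] at hx
      rcases hx with (⟨-, rfl⟩ | ⟨-, rfl⟩) | hx
      · exact Or.inl rfl
      · exact Or.inr rfl
      · exact h2 x hx
    · rw [dims_append, dims_append, dims_replicate, dims_replicate, h3, Finset.prod_insert hk,
        Pi.mulSingle_mul]

end GArray

theorem corollary1 (r : ℕ) (s : Fin r → ℕ) (a b c d e u : ℕ)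
    (hprod : ∏ k, s k = 2 ^ (a + u) * 3 ^ b * 5 ^ c * 11 ^ d * 13 ^ e)
    (hle : b + c + d + e ≤ a + 2 * u + 1)
    (hu : u ≤ c + e)
    (hunsplit : GArray.HasUnsplitFactors s u) :
    ∃ A B : GArray s, GArray.IsQuaternaryGCAPair A B := by
  obtain ⟨p, q, hpq, hdvd⟩ := hunsplit
  choose m hm using hdvd
  obtain ⟨L₁, hlen₁, hmem₁, hdims₁⟩ := GArray.exists_dims_ten_twentySix p q Finset.univ
  rw [Finset.univ_prod_mulSingle] at hdims₁
  have hs : s = GArray.dims L₁ * m := by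
    rw [hdims₁]
    exact funext hm
  set P := ∑ k, p k with hP
  set Q := ∑ k, q k with hQ
  have hPQ : P + Q = u := by rw [hP, hQ, ← Finset.sum_add_distrib, hpq]
  have hfactor : 2 ^ (a + u) * 3 ^ b * 5 ^ c * 11 ^ d * 13 ^ e =
      2 ^ u * 5 ^ P * 13 ^ Q * ∏ k, m k := by
    rw [← hprod, Finset.prod_congr rfl fun k _ => hm k, Finset.prod_mul_distrib,
      Finset.prod_mul_distrib, Finset.prod_pow_eq_pow_sum, Finset.prod_pow_eq_pow_sum, ← hP, ← hQ,
      ← hPQ, show 10 = 2 * 5 from rfl, show 26 = 2 * 13 from rfl, mul_pow, mul_pow]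
    ring
  -- The chosen factors `10` and `26` use up `P` of the factors `5` and `Q` of the factors `13`.
  have hPc : P ≤ c := by
    rw [← Nat.pow_dvd_pow_iff_le_right (x := 5) (by norm_num)]
    have h1 : 5 ^ P ∣ 5 ^ c * (2 ^ (a + u) * 3 ^ b * 11 ^ d * 13 ^ e) :=
      ⟨2 ^ u * 13 ^ Q * ∏ k, m k, by linear_combination hfactor⟩
    refine Nat.Coprime.dvd_of_dvd_mul_right ?_ h1
    refine Nat.Coprime.pow_left _ ?_
    refine Nat.Coprime.mul_right (Nat.Coprime.mul_right (Nat.Coprime.mul_right ?_ ?_) ?_) ?_ <;>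
      exact Nat.Coprime.pow_right _ (by norm_num)
  have hQe : Q ≤ e := by
    rw [← Nat.pow_dvd_pow_iff_le_right (x := 13) (by norm_num)]
    have h1 : 13 ^ Q ∣ 13 ^ e * (2 ^ (a + u) * 3 ^ b * 5 ^ c * 11 ^ d) :=
      ⟨2 ^ u * 5 ^ P * ∏ k, m k, by linear_combination hfactor⟩
    refine Nat.Coprime.dvd_of_dvd_mul_right ?_ h1
    refine Nat.Coprime.pow_left _ ?_
    refine Nat.Coprime.mul_right (Nat.Coprime.mul_right (Nat.Coprime.mul_right ?_ ?_) ?_) ?_ <;>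
      exact Nat.Coprime.pow_right _ (by norm_num)
  obtain ⟨c, rfl⟩ := Nat.exists_eq_add_of_le hPc
  obtain ⟨e, rfl⟩ := Nat.exists_eq_add_of_le hQe
  have hmprod : ∏ k, m k = 2 ^ a * 3 ^ b * 5 ^ c * 11 ^ d * 13 ^ e := by
    have h0 : 0 < 2 ^ u * 5 ^ P * 13 ^ Q := by positivity
    refine Nat.eq_of_mul_eq_mul_left h0 ?_
    rw [← hfactor]
    ring
  obtain ⟨L, hL, hLm⟩ := GArray.exists_dims_eq (List.replicate a 2 ++ (List.replicate b 3 ++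
    List.replicate c 5 ++ List.replicate d 11 ++ List.replicate e 13)) m
    (by
      simp only [List.mem_append, List.mem_replicate]
      rintro n (⟨-, rfl⟩ | ((⟨-, rfl⟩ | ⟨-, rfl⟩) | ⟨-, rfl⟩) | ⟨-, rfl⟩) <;> norm_num)
    (by
      rw [hmprod]
      simp [mul_assoc])
  obtain ⟨L₂, M, rfl, hL₂, hM⟩ := List.map_eq_append_iff.1 hL
  have hlen₂ : L₂.length = a := by simpa using congrArg List.length hL₂
  have hlenM : M.length = b + c + d + e := by
    simpa [add_assoc] using congrArg List.length hM
  have hpair := GArray.hasPair_dims (L₁ ++ L₂) M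
    (by
      intro x hx
      rcases List.mem_append.1 hx with hx | hx
      · exact Or.inr (hmem₁ x hx)
      · have := List.mem_map_of_mem (f := Prod.snd) hx
        rw [hL₂] at this
        exact Or.inl (List.eq_of_mem_replicate this))
    (by
      intro x hx
      have := List.mem_map_of_mem (f := Prod.snd) hx
      rw [hM] at this
      simp only [List.mem_append, List.mem_replicate] at this
      tauto)
    (by
      rw [List.length_append, hlen₁, hpq, hlen₂, hlenM]
      omega)
  rw [GArray.dims_append, mul_assoc, ← GArray.dims_append, hLm, ← hs] at hpair
  exact hpair.exists_isQuaternaryGCAPair
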